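/- A set $T\subset\mathbb{R}^2$ satisfies the $r$-rolling condition if for every $x\in\partial T$ there is an open ball $B$ of radius $r$ with $B\cap T=\emptyset$ and $x\in\partial B$. For $\alpha>0$ and a finite set $\mathcal{X}\subset\mathbb{R}^2$, two distinct points $x,y\in\mathcal{X}$ form an $\alpha$-edge (with endpoints $x$ and $y$) if there is an open ball $B$ of radius $\alpha$ with $x,y\in\partial B$ and $B\cap\mathcal{X}=\emptyset$. **Proposition.** For all $0<\alpha<r$ and $d\in\mathbb{R}$ there is a constant $A>0$, depending only on $(\alpha,r,d)$, such that the following holds. Let $S\subset\mathbb{R}^2$ be a compact set of diameter $d$ such that both $S$ and $S^{\mathsf c}=\mathbb{R}^2\setminus S$ satisfy the $r$-rolling condition, and let $X_1,\dots,X_n$ be independent random points, each uniformly distributed on $S$, with $\mathcal{X}_n=\{X_1,\dots,X_n\}$. Then, with probability at least $1-Ae^{-n/A}$, for every connected component $\Gamma$ of $\partial S$ there is an $\alpha$-edge of $\mathcal{X}_n$ with an endpoint at distance less than $\alpha$ from $\Gamma$. -/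

import Mathlib

open MeasureTheory ProbabilityTheory

/-- The Euclidean plane. -/
abbrev Plane : Type := EuclideanSpace ℝ (Fin 2)

/-- The `r`-rolling condition: every boundary point of `S` lies on the boundary circle of an open
ball of radius `r` that does not meet `S`. -/
def RollingCondition (r : ℝ) (S : Set Plane) : Prop :=
  ∀ x ∈ frontier S, ∃ c : Plane, Disjoint (Metric.ball c r) S ∧ x ∈ Metric.sphere c r

/-- The points `x` and `y` form an `α`-edge of the point set `D`: they are distinct points of `D`
on the boundary of an open ball of radius `α` that contains no point of `D`. -/
def IsAlphaEdge (α : ℝ) (D : Set Plane) (x y : Plane) : Prop :=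
  x ∈ D ∧ y ∈ D ∧ x ≠ y ∧
    ∃ c : Plane, x ∈ Metric.sphere c α ∧ y ∈ Metric.sphere c α ∧ Disjoint (Metric.ball c α) D

/-! At a boundary point `p` the inner and outer rolling balls are tangent, with common unit normal
`v`. Slide an open `α`-ball with centre `p + s • v` from `s = α`, where it lies in the outer ball
and misses the sample, towards `S` until it touches a sample point `x`. If the sample is dense at
scale `ε = α * (r - α) / (8 * r)`, this happens while `s` is near `α`; as `x` avoids the outer
`r`-ball and `α < r`, it lies within `α` of `p`. Pivoting the ball about `x` until it meets another
sample point gives the edge (`exists_isAlphaEdge_near`). Density has exponentially small failure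
probability by a union bound over a finite cover that depends only on `ε` and `d`
(`exists_uniform_sample_dense`). -/

/-- If a ball of radius `α` touching a finite set `D` at `x` contains no point of `D`, and `D` has
another point within `2 * α` of `x`, then `x` is an endpoint of an `α`-edge. -/
lemma exists_isAlphaEdge_of_empty_ball {α : ℝ} (hα : 0 < α) {D : Set Plane} (hD : D.Finite)
    {x y c : Plane} (hx : x ∈ D) (hy : y ∈ D) (hxy : y ≠ x) (hyx : dist y x ≤ 2 * α)
    (hc : x ∈ Metric.sphere c α) (hdisj : Disjoint (Metric.ball c α) D) :
    ∃ z, IsAlphaEdge α D x z := by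
  have hne : (D \ {x}).Nonempty := ⟨y, hy, hxy⟩
  have hn : 0 < ‖y - x‖ := norm_pos_iff.2 (sub_ne_zero.2 hxy)
  have hconn : IsPreconnected (Metric.sphere x α) :=
    isPreconnected_sphere (by rw [← Module.finrank_eq_rank]; simp) x α
  have hstart : α ≤ Metric.infDist c (D \ {x}) := by
    refine (Metric.le_infDist hne).2 fun z hz => ?_
    by_contra! h
    exact Set.disjoint_left.1 hdisj (by rwa [Metric.mem_ball, dist_comm]) hz.1
  -- The centre on the ray from `x` through `y`: its distance to `y` is at most `α` because `dist y
  -- x ≤ 2 * α`.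
  set c' : Plane := x + (α / ‖y - x‖) • (y - x) with hc'
  have hc'mem : c' ∈ Metric.sphere x α := by
    simp [hc', norm_smul, abs_of_pos hα, hn.ne']
  have hend : Metric.infDist c' (D \ {x}) ≤ α := by
    refine (Metric.infDist_le_dist_of_mem (show y ∈ D \ {x} from ⟨hy, hxy⟩)).trans ?_
    have h : c' - y = (α / ‖y - x‖ - 1) • (y - x) := by rw [hc']; module
    have h2 : (α / ‖y - x‖ - 1) * ‖y - x‖ = α - ‖y - x‖ := by field_simp
    rw [dist_eq_norm, h, norm_smul, Real.norm_eq_abs, ← abs_of_pos hn, ← abs_mul, abs_of_pos hn,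
      h2, abs_le]
    rw [dist_eq_norm] at hyx
    constructor <;> linarith
  -- The pivot: on the connected circle of centres about `x`, some centre is at distance exactly `α`
  -- from the rest of `D`.
  obtain ⟨e, he, hee⟩ := hconn.intermediate_value hc'mem
    (show c ∈ Metric.sphere x α by rwa [Metric.mem_sphere'])
    (Metric.continuous_infDist_pt (D \ {x})).continuousOn ⟨hend, hstart⟩
  obtain ⟨z, hz, hze⟩ := (hD.subset Set.sdiff_subset).isCompact.exists_infDist_eq_dist hne e
  refine ⟨z, hx, hz.1, fun h => hz.2 h.symm, e, by rwa [Metric.mem_sphere'], ?_, ?_⟩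
  · rw [Metric.mem_sphere', ← hze]; exact hee
  · refine Set.disjoint_left.2 fun w hw hwD => ?_
    rw [Metric.mem_ball'] at hw
    by_cases h : w = x
    · rw [h, Metric.mem_sphere.1 he] at hw; exact lt_irrefl _ hw
    · have := Metric.infDist_le_dist_of_mem (x := e) (show w ∈ D \ {x} from ⟨hwD, h⟩)
      have h3 : Metric.infDist e (D \ {x}) = α := hee
      linarith

/-- A point of the circle of radius `α` centred at `p + s • v` that lies outside the ball of radius
`r` centred at `p + r • v` is close to `p` when `s` is close to `α < r`. -/
lemma dist_lt_of_mem_sphere_of_notMem_ball {α r s : ℝ} (hα : 0 < α) (hαr : α < r)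
    {p v x : Plane} (hv : ‖v‖ = 1) (hs : α - 2 * (α * (r - α) / (8 * r)) ≤ s) (hsα : s ≤ α)
    (hxs : dist x (p + s • v) = α) (hxr : r ≤ dist x (p + r • v)) :
    dist x p < α := by
  have hr : 0 < r := hα.trans hαr
  have key (t : ℝ) : dist x (p + t • v) ^ 2 = ‖x - p‖ ^ 2 - 2 * t * inner ℝ (x - p) v + t ^ 2 := by
    rw [dist_eq_norm, show x - (p + t • v) = (x - p) - t • v by module, norm_sub_sq_real,
      inner_smul_right, norm_smul, hv, mul_one, Real.norm_eq_abs, sq_abs]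
    ring
  have h1 := key s
  have h2 := key r
  rw [hxs] at h1
  rw [dist_eq_norm]
  set N := ‖x - p‖
  set a : ℝ := inner ℝ (x - p) v
  have hN : 0 ≤ N := norm_nonneg _
  have h2' : 2 * r * a ≤ N ^ 2 := by nlinarith
  have hε : α * (r - α) / (8 * r) * (8 * r) = α * (r - α) := by field_simp
  set ε := α * (r - α) / (8 * r)
  have hε0 : 0 < ε := by
    have : 0 < α * (r - α) := mul_pos hα (by linarith)
    positivity
  have hεα : 8 * ε < α := by nlinarith
  have hs0 : 0 ≤ s := by linarith
  have h3 : α ^ 2 - s ^ 2 ≤ 4 * α * ε := by nlinarith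
  -- Eliminating `a` leaves `(r - α) * N ^ 2 ≤ 4 * r * α * ε`, which is half of `(r - α) * α ^ 2` by
  -- the choice of `ε`.
  have h4 : r * N ^ 2 ≤ r * (4 * α * ε) + α * N ^ 2 := by
    have e1 : r * N ^ 2 = r * (α ^ 2 - s ^ 2) + s * (2 * r * a) := by linear_combination -r * h1
    have e2 : s * (2 * r * a) ≤ s * N ^ 2 := mul_le_mul_of_nonneg_left h2' hs0
    have e3 : s * N ^ 2 ≤ α * N ^ 2 := mul_le_mul_of_nonneg_right hsα (sq_nonneg _)
    have e4 := mul_le_mul_of_nonneg_left h3 hr.le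
    linarith
  have h5 : (r - α) * N ^ 2 < (r - α) * α ^ 2 := by
    have : 0 < (r - α) * α ^ 2 := mul_pos (by linarith) (by positivity)
    nlinarith
  exact lt_of_pow_lt_pow_left₀ 2 hα.le (lt_of_mul_lt_mul_left h5 (by linarith))

/-- At a boundary point of a set that, like its complement, satisfies the `r`-rolling condition,
the two rolling balls are tangent to each other. -/
lemma exists_unit_normal {r : ℝ} (hr : 0 < r) {S : Set Plane}
    (hS : RollingCondition r S) (hSc : RollingCondition r Sᶜ) {p : Plane} (hp : p ∈ frontier S) :
    ∃ v : Plane, ‖v‖ = 1 ∧ Disjoint (Metric.ball (p + r • v) r) S ∧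
      Metric.ball (p - r • v) r ⊆ S := by
  obtain ⟨c, hc, hpc⟩ := hS p hp
  obtain ⟨c', hc', hpc'⟩ := hSc p (by rwa [frontier_compl])
  have hsub : Metric.ball c' r ⊆ S := Set.disjoint_compl_right_iff_subset.1 hc'
  have hballs : Disjoint (Metric.ball c r) (Metric.ball c' r) := hc.mono_right hsub
  have hcc : r + r ≤ dist c c' := (disjoint_ball_ball_iff hr hr).1 hballs
  rw [mem_sphere_iff_norm] at hpc hpc'
  -- Two vectors of length `r` whose difference has length at least `2 * r` are opposite.
  have hsum : (c - p) + (c' - p) = 0 := by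
    have h := parallelogram_law_with_norm ℝ (c - p) (c' - p)
    rw [norm_sub_rev c p, norm_sub_rev c' p, hpc, hpc', sub_sub_sub_cancel_right,
      ← dist_eq_norm] at h
    exact norm_eq_zero.1 (by nlinarith [norm_nonneg ((c - p) + (c' - p))])
  have hv : p + r • (r⁻¹ • (c - p)) = c := by rw [smul_inv_smul₀ hr.ne']; abel
  have hv' : p - r • (r⁻¹ • (c - p)) = c' := by
    rw [smul_inv_smul₀ hr.ne', eq_neg_of_add_eq_zero_left hsum]; abel
  refine ⟨r⁻¹ • (c - p), ?_, by rwa [hv], by rwa [hv']⟩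
  rw [norm_smul, norm_sub_rev, hpc, norm_inv, Real.norm_of_nonneg hr.le, inv_mul_cancel₀ hr.ne']

/-- If a finite subset `D` of `S` meets every ball of radius `α * (r - α) / (8 * r)` inside `S`,
then it has an `α`-edge with an endpoint close to any given boundary point of `S`. -/
lemma exists_isAlphaEdge_near {α r : ℝ} (hα : 0 < α) (hαr : α < r) {S : Set Plane}
    (hS : RollingCondition r S) (hSc : RollingCondition r Sᶜ) {D : Set Plane} (hD : D.Finite)
    (hDS : D ⊆ S)
    (hdense : ∀ q, Metric.ball q (α * (r - α) / (8 * r)) ⊆ S →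
      (D ∩ Metric.ball q (α * (r - α) / (8 * r))).Nonempty)
    {p : Plane} (hp : p ∈ frontier S) :
    ∃ x y, IsAlphaEdge α D x y ∧ dist x p < α := by
  have hr : 0 < r := hα.trans hαr
  obtain ⟨v, hv, hout, hin⟩ := exists_unit_normal hr hS hSc hp
  have hdist (s t : ℝ) : dist (p + s • v) (p + t • v) = |s - t| := by
    rw [dist_add_left, dist_eq_norm, ← sub_smul, norm_smul, hv, mul_one, Real.norm_eq_abs]
  have hlt := @dist_lt_of_mem_sphere_of_notMem_ball α r
  have hε : α * (r - α) / (8 * r) * (8 * r) = α * (r - α) := by field_simp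
  set ε := α * (r - α) / (8 * r)
  have hε0 : 0 < ε := by
    have : 0 < α * (r - α) := mul_pos hα (by linarith)
    positivity
  have hεα : 8 * ε < α := by nlinarith
  have hsub (t : ℝ) (ht : ε ≤ t) (ht' : t ≤ r) : Metric.ball (p + (-t) • v) ε ⊆ S := by
    refine (Metric.ball_subset_ball' ?_).trans hin
    rw [sub_eq_add_neg, ← neg_smul, hdist, abs_of_nonneg] <;> linarith
  -- Two distinct sample points near `p`, at depths about `ε` and `3 * ε`, so that one remains as
  -- pivot target if `x` is the other.
  obtain ⟨y₁, hy₁D, hy₁⟩ := hdense _ (hsub ε le_rfl (by linarith))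
  obtain ⟨y₂, hy₂D, hy₂⟩ := hdense _ (hsub (3 * ε) (by linarith) (by linarith))
  have hy₁₂ : y₁ ≠ y₂ := by
    rintro rfl
    refine Set.disjoint_left.1 (Metric.ball_disjoint_ball ?_) hy₁ hy₂
    rw [hdist, show -ε - -(3 * ε) = 2 * ε by ring, abs_of_pos] <;> linarith
  have hnear {y : Plane} {t : ℝ} (ht : 0 ≤ t) (hy : y ∈ Metric.ball (p + (-t) • v) ε) :
      dist y p < t + ε := by
    have := hdist (-t) 0
    rw [zero_smul, add_zero, sub_zero, abs_neg, abs_of_nonneg ht] at this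
    linarith [dist_triangle y (p + (-t) • v) p, Metric.mem_ball.1 hy]
  have hne : D.Nonempty := ⟨y₁, hy₁D⟩
  have hcont : Continuous fun s : ℝ => Metric.infDist (p + s • v) D :=
    (Metric.continuous_infDist_pt D).comp (by fun_prop)
  have hout' (z : Plane) (hz : z ∈ D) : r ≤ dist z (p + r • v) := by
    by_contra! h
    exact Set.disjoint_left.1 hout h (hDS hz)
  have hlow : Metric.infDist (p + (α - 2 * ε) • v) D ≤ α := by
    refine (Metric.infDist_le_dist_of_mem hy₁D).trans ?_
    have := hdist (α - 2 * ε) (-ε)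
    rw [abs_of_nonneg (by linarith)] at this
    linarith [dist_triangle_right (p + (α - 2 * ε) • v) y₁ (p + (-ε) • v), Metric.mem_ball.1 hy₁]
  have hhigh : α ≤ Metric.infDist (p + α • v) D := by
    refine (Metric.le_infDist hne).2 fun z hz => ?_
    have := hdist α r
    rw [abs_sub_comm, abs_of_nonneg (by linarith)] at this
    linarith [dist_triangle_left z (p + r • v) (p + α • v), hout' z hz]
  obtain ⟨s, ⟨hs, hsα⟩, hsD⟩ := intermediate_value_Icc (by linarith) hcont.continuousOn
    (show α ∈ Set.Icc _ _ from ⟨hlow, hhigh⟩)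
  obtain ⟨x, hxD, hx⟩ := hD.isCompact.exists_infDist_eq_dist hne (p + s • v)
  replace hx : dist x (p + s • v) = α := by rw [dist_comm, ← hx]; exact hsD
  have hxp : dist x p < α := hlt hα hαr hv hs hsα hx (hout' x hxD)
  have hempty : Disjoint (Metric.ball (p + s • v) α) D := by
    refine Set.disjoint_left.2 fun w hw hwD => ?_
    rw [Metric.mem_ball', ← hsD] at hw
    exact (Metric.infDist_le_dist_of_mem hwD).not_gt hw
  obtain ⟨y, hyD, hyx, hyp⟩ : ∃ y ∈ D, y ≠ x ∧ dist y p ≤ α := by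
    by_cases h : y₁ = x
    · exact ⟨y₂, hy₂D, fun h' => hy₁₂ (h.trans h'.symm),
        by linarith [hnear (by linarith) hy₂]⟩
    · exact ⟨y₁, hy₁D, h, by linarith [hnear hε0.le hy₁]⟩
  obtain ⟨z, hz⟩ := exists_isAlphaEdge_of_empty_ball hα hD hxD hyD hyx
    (by linarith [dist_triangle_right y x p]) hx hempty
  exact ⟨x, z, hz, hxp⟩

/-- The probability that `n` independent uniform points on `S` all miss a subset of `S`. -/
lemma measureReal_forall_notMem_le {S B : Set Plane} (hS : MeasurableSet S) (hB : MeasurableSet B)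
    (hBS : B ⊆ S) (hSfin : volume S ≠ ⊤) {q : ℝ} (hB0 : 0 < volume.real B)
    (hq : q * volume.real S ≤ volume.real B)
    {Ω : Type*} [MeasurableSpace Ω] (P : Measure Ω) [IsProbabilityMeasure P]
    {n : ℕ} {X : Fin n → Ω → Plane} (hX : ∀ i, Measurable (X i)) (hind : iIndepFun X P)
    (hunif : ∀ i, pdf.IsUniform (X i) S P volume) :
    P.real {ω | ∀ i, X i ω ∉ B} ≤ Real.exp (-(n * q)) := by
  have hset : {ω | ∀ i, X i ω ∉ B} = ⋂ i ∈ Finset.univ, X i ⁻¹' Bᶜ := by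
    ext ω; simp
  have hS0 : 0 < volume.real S :=
    hB0.trans_le (measureReal_mono hBS hSfin)
  have hone (i : Fin n) : P.real (X i ⁻¹' Bᶜ) ≤ Real.exp (-q) := by
    have h1 : P.real (X i ⁻¹' B) = volume.real B / volume.real S := by
      rw [← map_measureReal_apply (hX i) hB, hunif i, measureReal_def, cond_apply hS,
        Set.inter_eq_self_of_subset_right hBS, ENNReal.toReal_mul, ENNReal.toReal_inv,
        div_eq_inv_mul, measureReal_def, measureReal_def]
    have h2 : q ≤ volume.real B / volume.real S := (le_div_iff₀ hS0).2 hq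
    rw [Set.preimage_compl, probReal_compl_eq_one_sub (hX i hB), h1]
    linarith [Real.add_one_le_exp (-q)]
  rw [hset, measureReal_def, hind.measure_inter_preimage_eq_mul Finset.univ
    (fun i _ => hB.compl), ENNReal.toReal_prod]
  calc ∏ i, P.real (X i ⁻¹' Bᶜ) ≤ ∏ _i : Fin n, Real.exp (-q) :=
        Finset.prod_le_prod (fun i _ => measureReal_nonneg) fun i _ => hone i
    _ = Real.exp (-(n * q)) := by
        rw [Finset.prod_const, Finset.card_univ, Fintype.card_fin, ← Real.exp_nat_mul, mul_neg]

/-- With exponentially high probability, independent uniform points on `S` meet every ball of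
radius `ε` inside `S`. The constants depend only on `ε` and the diameter of `S`. -/
lemma exists_uniform_sample_dense (ε d : ℝ) (hε : 0 < ε) :
    ∃ A : ℝ, 0 < A ∧ ∀ S : Set Plane, IsCompact S → Metric.diam S = d →
      ∀ (Ω : Type*) [MeasurableSpace Ω] (P : Measure Ω) [IsProbabilityMeasure P]
        (n : ℕ) (X : Fin n → Ω → Plane),
        (∀ i, Measurable (X i)) → iIndepFun X P →
        (∀ i, pdf.IsUniform (X i) S P volume) →
        ∃ E : Set Ω, MeasurableSet E ∧ 1 - A * Real.exp (-(n : ℝ) / A) ≤ P.real E ∧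
          ∀ ω ∈ E, (∀ i, X i ω ∈ S) ∧
            ∀ q, Metric.ball q ε ⊆ S → ∃ i, X i ω ∈ Metric.ball q ε := by
  obtain ⟨t, ht, hcover⟩ := Metric.totallyBounded_iff.1
    (isCompact_closedBall (0 : Plane) (|d| + 1)).totallyBounded (ε / 2) (by positivity)
  lift t to Finset Plane using ht
  set V := volume.real (Metric.closedBall (0 : Plane) (|d| + 1))
  set W := volume.real (Metric.ball (0 : Plane) (ε / 2))
  have hV : 0 < V := ENNReal.toReal_pos
    (Metric.measure_closedBall_pos volume _ (by positivity)).ne' measure_closedBall_lt_top.ne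
  have hW : 0 < W := ENNReal.toReal_pos
    (Metric.measure_ball_pos volume _ (by positivity)).ne' measure_ball_lt_top.ne
  -- `t.card` pays for the union bound; `V / W` makes `1 / A` at most the chance of hitting a given
  -- cover ball inside `S`.
  refine ⟨max t.card (V / W), lt_max_of_lt_right (by positivity), ?_⟩
  intro S hS hdiam Ω _ P _ n X hX hind hunif
  set A := max (t.card : ℝ) (V / W)
  have hA : 0 < A := lt_max_of_lt_right (by positivity)
  -- For empty `S`, uniformity is vacuous when `n = 0` and impossible otherwise.
  rcases S.eq_empty_or_nonempty with rfl | ⟨x₀, hx₀⟩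
  · rcases n.eq_zero_or_pos with rfl | hn
    · refine ⟨Set.univ, .univ, by simp [hA.le], fun ω _ => ⟨fun i => i.elim0, fun q hq => ?_⟩⟩
      exact absurd (hq (Metric.mem_ball_self hε)) (Set.notMem_empty q)
    · exfalso
      have h : P.map (X ⟨0, hn⟩) = 0 := by rw [hunif ⟨0, hn⟩]; simp [ProbabilityTheory.cond]
      have := Measure.isProbabilityMeasure_map (μ := P) (hX ⟨0, hn⟩).aemeasurable
      exact IsProbabilityMeasure.ne_zero _ h
  have hSball : S ⊆ Metric.closedBall x₀ (|d| + 1) := fun z hz => by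
    rw [Metric.mem_closedBall]
    linarith [Metric.dist_le_diam_of_mem hS.isBounded hz hx₀, le_abs_self d]
  have hSV : volume.real S ≤ V := by
    refine (measureReal_mono hSball measure_closedBall_lt_top.ne).trans_eq ?_
    simp only [V, measureReal_def, Measure.addHaar_closedBall_center]
  classical
  set T := t.filter fun z => Metric.ball (x₀ + z) (ε / 2) ⊆ S
  set F : Plane → Set Ω := fun z => {ω | ∀ i, X i ω ∉ Metric.ball (x₀ + z) (ε / 2)}
  set G : Set Ω := {ω | ∃ i, X i ω ∉ S}
  have hFm (z : Plane) : MeasurableSet (F z) := by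
    simp only [F, Set.ofPred_forall]
    exact .iInter fun i => (hX i) measurableSet_ball.compl
  have hGm : MeasurableSet G := by
    simp only [G, Set.ofPred_exists]
    exact .iUnion fun i => (hX i) hS.measurableSet.compl
  have hG0 : P.real G = 0 := by
    simp only [G, Set.ofPred_exists, measureReal_def]
    rw [measure_iUnion_null fun i => ?_, ENNReal.toReal_zero]
    change P (X i ⁻¹' Sᶜ) = 0
    rw [← Measure.map_apply (hX i) hS.measurableSet.compl, hunif i, cond_apply hS.measurableSet,
      Set.inter_compl_self, measure_empty, mul_zero]
  have hF (z : Plane) (hz : z ∈ T) : P.real (F z) ≤ Real.exp (-(n : ℝ) / A) := by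
    have hvol : volume.real (Metric.ball (x₀ + z) (ε / 2)) = W := by
      simp only [W, measureReal_def, Measure.addHaar_ball_center]
    refine (measureReal_forall_notMem_le hS.measurableSet measurableSet_ball
      (Finset.mem_filter.1 hz).2 hS.measure_lt_top.ne (q := A⁻¹) (by rwa [hvol]) ?_ P hX hind
      hunif).trans_eq (by rw [neg_div, div_eq_mul_inv])
    rw [hvol, inv_mul_le_iff₀ hA]
    exact hSV.trans ((div_le_iff₀ hW).1 (le_max_right _ _))
  have hbad : P.real (G ∪ ⋃ z ∈ T, F z) ≤ A * Real.exp (-(n : ℝ) / A) := by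
    calc P.real (G ∪ ⋃ z ∈ T, F z) ≤ P.real G + P.real (⋃ z ∈ T, F z) := measureReal_union_le _ _
      _ ≤ ∑ z ∈ T, P.real (F z) := by
        rw [hG0, zero_add]; exact measureReal_biUnion_finset_le _ _
      _ ≤ ∑ _z ∈ T, Real.exp (-(n : ℝ) / A) := Finset.sum_le_sum hF
      _ = T.card * Real.exp (-(n : ℝ) / A) := by rw [Finset.sum_const, nsmul_eq_mul]
      _ ≤ A * Real.exp (-(n : ℝ) / A) := by
        gcongr
        exact le_max_of_le_left (by exact_mod_cast Finset.card_filter_le _ _)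
  have hbadm : MeasurableSet (G ∪ ⋃ z ∈ T, F z) :=
    hGm.union (T.measurableSet_biUnion fun z _ => hFm z)
  refine ⟨_, hbadm.compl, ?_, fun ω hω => ?_⟩
  · rw [probReal_compl_eq_one_sub hbadm]; linarith
  simp only [Set.mem_compl_iff, Set.mem_union, Set.mem_iUnion, not_or, not_exists, G, F,
    Set.mem_ofPred_eq, not_not, not_forall] at hω
  refine ⟨hω.1, fun q hq => ?_⟩
  have hqS := hSball (hq (Metric.mem_ball_self hε))
  have hq' : q - x₀ ∈ Metric.closedBall (0 : Plane) (|d| + 1) := by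
    rwa [mem_closedBall_zero_iff, ← mem_closedBall_iff_norm]
  obtain ⟨z, hz, hqz⟩ := Set.mem_iUnion₂.1 (hcover hq')
  -- Halving the radius puts a whole cover ball inside any `ε`-ball, so only cover balls contained
  -- in `S` matter.
  have hsub : Metric.ball (x₀ + z) (ε / 2) ⊆ Metric.ball q ε := by
    refine Metric.ball_subset_ball' ?_
    rw [Metric.mem_ball, dist_eq_norm] at hqz
    rw [dist_comm, dist_eq_norm, ← sub_sub]
    linarith
  obtain ⟨i, hi⟩ := hω.2 z (Finset.mem_filter.2 ⟨hz, hsub.trans hq⟩)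
  exact ⟨i, hsub hi⟩

theorem mainTheorem6 (α r d : ℝ) (hα : 0 < α) (hαr : α < r) :
    ∃ A : ℝ, 0 < A ∧
      ∀ S : Set Plane, IsCompact S → RollingCondition r S → RollingCondition r Sᶜ →
        Metric.diam S = d →
      ∀ (Ω : Type*) [MeasurableSpace Ω] (P : Measure Ω) [IsProbabilityMeasure P]
        (n : ℕ) (X : Fin n → Ω → Plane),
        (∀ i, Measurable (X i)) → iIndepFun X P →
        (∀ i, pdf.IsUniform (X i) S P volume) →
        ∃ E : Set Ω, MeasurableSet E ∧ 1 - A * Real.exp (-(n : ℝ) / A) ≤ P.real E ∧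
          ∀ ω ∈ E, ∀ p ∈ frontier S, ∃ x y : Plane,
            IsAlphaEdge α (Set.range fun i => X i ω) x y ∧
              Metric.infDist x (connectedComponentIn (frontier S) p) < α := by
  have hε : 0 < α * (r - α) / (8 * r) := by
    have : 0 < α * (r - α) := mul_pos hα (by linarith)
    have : 0 < r := hα.trans hαr
    positivity
  obtain ⟨A, hA, h⟩ := exists_uniform_sample_dense (α * (r - α) / (8 * r)) d hε
  refine ⟨A, hA, fun S hS hroll hroll' hdiam Ω _ P _ n X hX hind hunif => ?_⟩
  obtain ⟨E, hE, hPE, hgood⟩ := h S hS hdiam Ω P n X hX hind hunif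
  refine ⟨E, hE, hPE, fun ω hω p hp => ?_⟩
  obtain ⟨hXS, hdense⟩ := hgood ω hω
  obtain ⟨x, y, hxy, hxp⟩ := exists_isAlphaEdge_near hα hαr hroll hroll'
    (Set.finite_range fun i => X i ω) (Set.range_subset_iff.2 hXS)
    (fun q hq => (hdense q hq).elim fun i hi => ⟨X i ω, ⟨i, rfl⟩, hi⟩) hp
  exact ⟨x, y, hxy,
    (Metric.infDist_le_dist_of_mem (mem_connectedComponentIn hp)).trans_lt hxp⟩
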